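/- Let $k$ be an algebraically closed field and let $\mathcal{B}(\mathbb{P}^2)$ be the bubble space of $\mathbb{P}^2=\mathbb{P}^2_k$, i.e. the set of all points that belong to $\mathbb{P}^2$, as proper or infinitely near points. Let $$\mathcal{Z}=\mathbb{Z}e_0\oplus\bigoplus_{p\in\mathcal{B}(\mathbb{P}^2)}\mathbb{Z}e_p$$ be endowed with the intersection form given by $e_0^2=1$, $e_p^2=-1$, $e_0\cdot e_p=0$ and $e_p\cdot e_q=0$ for $p\neq q$. For $a\in\mathcal{Z}$ and $q\in\mathcal{B}(\mathbb{P}^2)$ put $\deg a=e_0\cdot a$, $m_q(a)=e_q\cdot a$ and $\operatorname{comult}(a)=\deg a-\max_q m_q(a)$. Let $\mathrm{Sym}$ be the group of the linear automorphisms of $\mathcal{Z}$ that fix $e_0$ and permute the $e_p$, $p\in\mathcal{B}(\mathbb{P}^2)$. Let $p_1=[1:0:0]$, $p_2=[0:1:0]$, $p_3=[0:0:1]$, and let $\sigma$ be the automorphism of $\mathcal{Z}$ induced by the standard quadratic transformation $[x:y:z]\dashrightarrow[yz:xz:xy]$: $\sigma(e_0)=2e_0-e_{p_1}-e_{p_2}-e_{p_3}$,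 $\sigma(e_{p_i})=e_0-\sum_{j\ne i}e_{p_j}$, and $\sigma(e_q)=e_{q'}$ for the other points $q$, where $q'$ is the point of $\mathcal{B}(\mathbb{P}^2)$ that corresponds to $q$ under this transformation. Let $W=\langle\mathrm{Sym},\sigma\rangle$ be the infinite Weyl group. For $f\in W$ put $\deg f=\deg f^{-1}(e_0)$ and $m_q(f)=m_q(f^{-1}(e_0))$, and say that $f$ is a Jonquières element if $m_q(f)=\deg f-1$ for some $q\in\mathcal{B}(\mathbb{P}^2)$. For $a\in W(e_0)$, a predecessor of $a$ is an element of minimal degree of $\{\varphi(a)\mid\varphi\in W\text{ a Jonquières element}\}$; an $n$-th predecessor of $a$ is an element $a_n$ for which there are $a=a_0,a_1,\dots,a_n$ such that $a_i$ is a predecessor of $a_{i-1}$ for $i=1,\dots,n$. Let $n\ge 1$, let $a_0\in W(e_0)$ and let $a_n\in W(e_0)$ be an $n$-th predecessor of $a_0$. Then for all Jonquières elements $\psi_1,\dots,\psi_n\in W$, the element $b_n=\psi_n\circ\dots\circ\psi_1(a_0)$ satisfies: 1. $\deg(a_n)\le\deg(b_n)$; 2. $\operatorname{comult}(a_n)\le\operatorname{comult}(b_n)$;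 3. if $\deg(a_n)=\deg(b_n)$, then $a_n$ and $b_n$ are equal modulo $\mathrm{Sym}$, i.e. there is $\alpha\in\mathrm{Sym}$ with $b_n=\alpha(a_n)$. -/

import Mathlib

noncomputable section

namespace Cremona

/-! ### The lattice `ℤ e₀ ⊕ ⨁_{p ∈ B} ℤ e_p` -/

section Lattice

/-- The free `ℤ`-module `ℤ e₀ ⊕ ⨁_{p ∈ B} ℤ e_p`; the pair `(d, c)` is `d e₀ + ∑ c(p) e_p`. -/
abbrev PicardManin (B : Type*) : Type _ := ℤ × (B →₀ ℤ)

variable {B : Type*}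

/-- The class `e₀` of a line. -/
def e₀ : PicardManin B := (1, 0)

/-- The class `e_p` of the exceptional divisor of `p`. -/
def e (p : B) : PicardManin B := (0, Finsupp.single p 1)

/-- The intersection form: `e₀² = 1`, `e_p² = -1`, and the other products of basis vectors
vanish. -/
def inter (a b : PicardManin B) : ℤ := a.1 * b.1 - a.2.sum fun p m => m * b.2 p

/-- The degree `deg a = e₀ · a`. -/
def deg (a : PicardManin B) : ℤ := inter e₀ a

/-- The multiplicity `m_q(a) = e_q · a`. -/
def mult (q : B) (a : PicardManin B) : ℤ := inter (e q) a

/-- The maximal multiplicity `max {m_q(a) | q ∈ B}`. -/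
def maxMult (a : PicardManin B) : ℤ := sSup (Set.range fun q : B => mult q a)

/-- The comultiplicity `deg a - m_max(a)`. -/
def comult (a : PicardManin B) : ℤ := deg a - maxMult a

/-- The group of the linear automorphisms that fix `e₀` and permute the `e_p`, `p ∈ B`.
They preserve the intersection form. -/
def Sym (B : Type*) : Subgroup (PicardManin B ≃ₗ[ℤ] PicardManin B) where
  carrier := {f | f e₀ = e₀ ∧ ∃ t : Equiv.Perm B, ∀ p, f (e p) = e (t p)}
  one_mem' := ⟨rfl, 1, fun _ => rfl⟩
  mul_mem' := by
    rintro f g ⟨hf, s, hs⟩ ⟨hg, t, ht⟩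
    exact ⟨by rw [LinearEquiv.mul_apply, hg, hf],
      s * t, fun p => by rw [LinearEquiv.mul_apply, ht, hs]; rfl⟩
  inv_mem' := by
    rintro f ⟨hf, s, hs⟩
    refine ⟨(LinearEquiv.symm_apply_eq f).2 hf.symm, s⁻¹, fun p => ?_⟩
    exact (LinearEquiv.symm_apply_eq f).2 (by rw [hs]; simp)

/-- `a` and `b` are equal modulo the group `Sym`. -/
def EqModSym (a b : PicardManin B) : Prop := ∃ α ∈ Sym B, b = α a

lemma mult_eq (q : B) (a : PicardManin B) : mult q a = - a.2 q := by
  simp [mult, inter, e]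

/-- The maximal multiplicity is a maximum. -/
lemma isGreatest_maxMult [Nonempty B] (a : PicardManin B) :
    IsGreatest (Set.range fun q : B => mult q a) (maxMult a) := by
  have hfin : (Set.range fun q : B => mult q a).Finite := by
    refine ((a.2.support.finite_toSet.image fun q => mult q a).union
      (Set.finite_singleton (0 : ℤ))).subset ?_
    rintro _ ⟨q, rfl⟩
    by_cases h : a.2 q = 0
    · right; simp [mult_eq, h]
    · left; exact ⟨q, by simpa using h, rfl⟩
  exact ⟨(Set.range_nonempty _).csSup_mem hfin, fun x hx => le_csSup hfin.bddAbove hx⟩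

end Lattice

/-! ### The bubble space of the projective plane

A point of the bubble space, that is the class of `(p, X, π)` with `π : X → ℙ²` a birational
morphism and `p` a closed point of `X`, is the same thing as the local ring `𝒪_{X,p}`, seen as a
subring of the function field of `ℙ²`. Since `π` is a sequence of blow-ups of closed points, these
local rings are the ones that are obtained from the local rings of the closed points of `ℙ²` by
taking repeatedly the local ring of a closed point of the exceptional curve of the blow-up of the
closed point. The function field of `ℙ²` is the subfield of the elements of degree `0` of
`k(X₀, X₁, X₂)`. -/

section Bubble

variable (k : Type*) [Field k]

/-- The field `k(X₀, X₁, X₂)`. -/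
abbrev RatFun : Type _ := FractionRing (MvPolynomial (Fin 3) k)

variable {k}

/-- A polynomial, as an element of `k(X₀, X₁, X₂)`. -/
abbrev ofPoly (F : MvPolynomial (Fin 3) k) : RatFun k :=
  algebraMap (MvPolynomial (Fin 3) k) (RatFun k) F

lemma ofPoly_ne_zero {F : MvPolynomial (Fin 3) k} (h : F ≠ 0) : ofPoly F ≠ 0 := by
  simp [h]

lemma ne_zero_of_eval {a : Fin 3 → k} {G : MvPolynomial (Fin 3) k}
    (h : MvPolynomial.eval a G ≠ 0) : G ≠ 0 := by
  rintro rfl; simp at h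

/-- The fractions `F / G` with `F`, `G` homogeneous of the same degree and `G(a) ≠ 0`. -/
def stalkSubring (a : Fin 3 → k) : Subring (RatFun k) where
  carrier := {f | ∃ (d : ℕ) (F G : MvPolynomial (Fin 3) k), F.IsHomogeneous d ∧
    G.IsHomogeneous d ∧ MvPolynomial.eval a G ≠ 0 ∧ f = ofPoly F / ofPoly G}
  one_mem' := ⟨0, 1, 1, MvPolynomial.isHomogeneous_one _ _,
    MvPolynomial.isHomogeneous_one _ _, by simp, by simp⟩
  zero_mem' := ⟨0, 0, 1, MvPolynomial.isHomogeneous_zero _ _ _,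
    MvPolynomial.isHomogeneous_one _ _, by simp, by simp⟩
  mul_mem' := by
    rintro _ _ ⟨d, F, G, hF, hG, h, rfl⟩ ⟨d', F', G', hF', hG', h', rfl⟩
    exact ⟨d + d', F * F', G * G', hF.mul hF', hG.mul hG', by simp [h, h'],
      by simp [ofPoly, div_mul_div_comm]⟩
  add_mem' := by
    rintro _ _ ⟨d, F, G, hF, hG, h, rfl⟩ ⟨d', F', G', hF', hG', h', rfl⟩
    refine ⟨d + d', F * G' + G * F', G * G', (hF.mul hG').add (hG.mul hF'), hG.mul hG',
      by simp [h, h'], ?_⟩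
    rw [div_add_div _ _ (ofPoly_ne_zero (ne_zero_of_eval h))
      (ofPoly_ne_zero (ne_zero_of_eval h'))]
    simp [ofPoly]
  neg_mem' := by
    rintro _ ⟨d, F, G, hF, hG, h, rfl⟩
    exact ⟨d, -F, G, hF.neg, hG, h, by simp [ofPoly, neg_div]⟩

/-- The local ring of `ℙ²` at the point `[a₀ : a₁ : a₂]`. -/
def stalk (a : Fin 3 → k) : LocalSubring (RatFun k) where
  toSubring := stalkSubring a
  isLocalRing := by
    refine IsLocalRing.of_isUnit_or_isUnit_one_sub_self ?_
    rintro ⟨_, d, F, G, hF, hG, h, rfl⟩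
    have hG0 := ofPoly_ne_zero (ne_zero_of_eval h)
    by_cases hFa : MvPolynomial.eval a F = 0
    · right
      have h1 : MvPolynomial.eval a (G - F) ≠ 0 := by simpa [hFa] using h
      have h10 := ofPoly_ne_zero (ne_zero_of_eval h1)
      refine IsUnit.of_mul_eq_one ⟨ofPoly G / ofPoly (G - F), d, G, G - F, hG, hG.sub hF, h1, rfl⟩
        (Subtype.ext ?_)
      change (1 - ofPoly F / ofPoly G) * (ofPoly G / ofPoly (G - F)) = 1
      have h2 : ofPoly (G - F) = ofPoly G - ofPoly F := by simp [ofPoly]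
      rw [h2] at h10 ⊢
      field_simp
    · left
      have h10 := ofPoly_ne_zero (ne_zero_of_eval hFa)
      refine IsUnit.of_mul_eq_one ⟨ofPoly G / ofPoly F, d, G, F, hG, hF, hFa, rfl⟩
        (Subtype.ext ?_)
      change ofPoly F / ofPoly G * (ofPoly G / ofPoly F) = 1
      field_simp

/-- The ring `R[v/u]`. If `u, v` generate the maximal ideal of `R`, this is an affine chart of
the blow-up of the closed point of `Spec R`. -/
def blowupChart (R : LocalSubring (RatFun k)) (u v : R.toSubring) : Subring (RatFun k) :=
  R.toSubring ⊔ Subring.closure {(v : RatFun k) / (u : RatFun k)}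

/-- The local rings of the points, proper or infinitely near, of `ℙ²`.

In the second case, `(u, v)` is a system of generators of the maximal ideal of `R`, and the maximal
ideals of `R[v/u]` which contain `u` are the closed points of the exceptional curve `u = 0` in the
chart; exchanging `u` and `v` gives the other chart. -/
inductive IsBubblePoint : LocalSubring (RatFun k) → Prop
  | proper (a : Fin 3 → k) (ha : a ≠ 0) : IsBubblePoint (stalk a)
  | infinitelyNear (R : LocalSubring (RatFun k)) (hR : IsBubblePoint R) (u v : R.toSubring)
      (huv : IsLocalRing.maximalIdeal R.toSubring = Ideal.span {u, v})
      (P : Ideal (blowupChart R u v)) [P.IsMaximal]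
      (hP : ∃ w ∈ P, (w : RatFun k) = (u : RatFun k)) :
      IsBubblePoint (LocalSubring.ofPrime (blowupChart R u v) P)

variable (k) in
/-- The bubble space of `ℙ²` over the algebraically closed field `k`. -/
def BubbleSpace : Type _ := {R : LocalSubring (RatFun k) // IsBubblePoint R}

/-- The points `[1:0:0]`, `[0:1:0]`, `[0:0:1]`. -/
def basePt (i : Fin 3) : BubbleSpace k :=
  ⟨stalk (Pi.single i 1), .proper _ (by simp)⟩

/-! ### The standard quadratic transformation -/

/-- The variables. -/
abbrev coord (i : Fin 3) : RatFun k := ofPoly (MvPolynomial.X i)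

lemma coord_ne_zero (i : Fin 3) : (coord i : RatFun k) ≠ 0 :=
  ofPoly_ne_zero (MvPolynomial.X_ne_zero i)

/-- The substitution `Xᵢ ↦ Xᵢ⁻¹`. -/
def invSubst : MvPolynomial (Fin 3) k →ₐ[k] RatFun k :=
  MvPolynomial.aeval fun i : Fin 3 => (coord i : RatFun k)⁻¹

lemma invSubst_X (i : Fin 3) :
    invSubst (MvPolynomial.X i) = (coord i : RatFun k)⁻¹ := by
  simp [invSubst]

lemma invSubst_aux (p : MvPolynomial (Fin 3) k) :
    ∃ q m : MvPolynomial (Fin 3) k, ofPoly m ≠ 0 ∧ invSubst m ≠ 0 ∧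
      ofPoly q = ofPoly m * invSubst p ∧ invSubst q = invSubst m * ofPoly p := by
  induction p using MvPolynomial.induction_on with
  | C a =>
    refine ⟨MvPolynomial.C a, 1, by simp, by simp, ?_, ?_⟩
    · simp only [ofPoly, invSubst, map_one, one_mul]
      exact (MvPolynomial.aeval_C _ a).symm
    · simp only [ofPoly, invSubst, map_one, one_mul]
      exact MvPolynomial.aeval_C _ a
  | add p p' h h' =>
    obtain ⟨q, m, h1, h2, h3, h4⟩ := h
    obtain ⟨q', m', h1', h2', h3', h4'⟩ := h'
    simp only [ofPoly] at h1 h2 h3 h4 h1' h2' h3' h4' ⊢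
    refine ⟨q * m' + m * q', m * m', ?_, ?_, ?_, ?_⟩
    · rw [map_mul]; exact mul_ne_zero h1 h1'
    · rw [map_mul]; exact mul_ne_zero h2 h2'
    · simp only [map_add, map_mul, h3, h3']; ring
    · simp only [map_add, map_mul, h4, h4']; ring
  | mul_X p n h =>
    obtain ⟨q, m, h1, h2, h3, h4⟩ := h
    have hn := coord_ne_zero (k := k) n
    simp only [ofPoly] at h1 h2 h3 h4 hn ⊢
    refine ⟨q, m * MvPolynomial.X n, ?_, ?_, ?_, ?_⟩
    · rw [map_mul]; exact mul_ne_zero h1 hn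
    · rw [map_mul, invSubst_X]; exact mul_ne_zero h2 (inv_ne_zero hn)
    · rw [map_mul, map_mul, invSubst_X, h3]; field_simp
    · rw [map_mul, map_mul, invSubst_X, h4]; field_simp

lemma invSubst_injective : Function.Injective (invSubst (k := k)) := by
  refine (injective_iff_map_eq_zero _).2 fun p hp => ?_
  obtain ⟨q, m, h1, h2, h3, h4⟩ := invSubst_aux p
  have hq : q = 0 := by simpa [hp] using h3
  have h5 : ofPoly p = 0 := by simpa [hq, h2] using h4
  simpa using h5

/-- The automorphism `Xᵢ ↦ Xᵢ⁻¹` of `k(X₀, X₁, X₂)`. On the elements of degree `0` it is the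
automorphism of the function field of `ℙ²` that is induced by the standard quadratic transformation
`[x : y : z] ⇢ [yz : xz : xy]`. -/
def quadAut : RatFun k →ₐ[k] RatFun k := 
  IsFractionRing.liftAlgHom (g := invSubst) invSubst_injective

lemma quadAut_ofPoly (p : MvPolynomial (Fin 3) k) : quadAut (ofPoly p) = invSubst p :=
  IsFractionRing.lift_algebraMap (A := MvPolynomial (Fin 3) k) (K := RatFun k)
    (g := (invSubst (k := k)).toRingHom) invSubst_injective p

lemma quadAut_coord (i : Fin 3) : quadAut (coord i : RatFun k) = (coord i)⁻¹ := by
  rw [quadAut_ofPoly, invSubst_X]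

lemma quadAut_comp : (quadAut (k := k)).toRingHom.comp (quadAut (k := k)).toRingHom =
    RingHom.id _ := by
  refine IsLocalization.ringHom_ext (nonZeroDivisors (MvPolynomial (Fin 3) k)) ?_
  refine MvPolynomial.ringHom_ext (fun a => ?_) (fun i => ?_)
  · have h : algebraMap (MvPolynomial (Fin 3) k) (RatFun k) (MvPolynomial.C a) =
        algebraMap k (RatFun k) a := rfl
    change quadAut (quadAut (algebraMap _ _ (MvPolynomial.C a))) = algebraMap _ _ _
    rw [h, AlgHom.commutes, AlgHom.commutes]
  · change quadAut (quadAut (coord i)) = coord i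
    rw [quadAut_coord, map_inv₀, quadAut_coord, inv_inv]

/-- The image of a local ring under the automorphism `Xᵢ ↦ Xᵢ⁻¹`. -/
def quadMap (R : LocalSubring (RatFun k)) : LocalSubring (RatFun k) :=
  R.map (quadAut (k := k)).toRingHom

lemma quadMap_quadMap (R : LocalSubring (RatFun k)) : quadMap (quadMap R) = R := by
  apply LocalSubring.toSubring_injective
  simp only [quadMap, LocalSubring.map_toSubring, Subring.map_map]
  rw [quadAut_comp, Subring.map_id]

open Classical in
/-- The bijection `q ↦ q'` induced by the standard quadratic transformation on the points of the
bubble space other than `[1:0:0]`, `[0:1:0]`, `[0:0:1]`. The image of the local ring of such a point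
is the local ring of a point of the bubble space. For the three points themselves it is not (see
`quadPt_basePt`), and they are fixed by convention. -/
def quadPt (q : BubbleSpace k) : BubbleSpace k :=
  if h : IsBubblePoint (quadMap q.1) then ⟨quadMap q.1, h⟩ else q

lemma quadPt_quadPt (q : BubbleSpace k) : quadPt (quadPt q) = q := by
  by_cases h : IsBubblePoint (quadMap q.1)
  · have h1 : quadPt q = ⟨quadMap q.1, h⟩ := dif_pos h
    have h2 : IsBubblePoint (quadMap (quadPt q).1) := by
      rw [h1, quadMap_quadMap]; exact q.2
    have h3 : quadPt (quadPt q) = ⟨quadMap (quadPt q).1, h2⟩ := dif_pos h2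
    rw [h3]
    apply Subtype.ext
    change quadMap (quadPt q).1 = q.1
    rw [h1, quadMap_quadMap]
  · have h1 : quadPt q = q := dif_neg h
    rw [h1, h1]

/-- The fraction `Xⱼ / Xₗ`, for `l ≠ i, j`, is not regular at the `i`-th coordinate point. -/
lemma coord_div_not_mem (i j l : Fin 3) (hl : l ≠ i) (hj : l ≠ j) :
    (coord j / coord l : RatFun k) ∉ stalkSubring (Pi.single i (1 : k)) := by
  rintro ⟨d, F, G, hF, hG, h, he⟩
  have hG0 := ofPoly_ne_zero (ne_zero_of_eval h)
  rw [div_eq_div_iff (coord_ne_zero l) hG0] at he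
  have he' : MvPolynomial.X j * G = F * MvPolynomial.X l := by
    apply IsFractionRing.injective (MvPolynomial (Fin 3) k) (RatFun k)
    rw [map_mul, map_mul]; exact he
  have hdvd : (MvPolynomial.X l : MvPolynomial (Fin 3) k) ∣ MvPolynomial.X j * G :=
    he' ▸ dvd_mul_left _ _
  rcases (MvPolynomial.X_prime (i := l) (R := k)).dvd_or_dvd hdvd with h1 | ⟨G', rfl⟩
  · exact hj (MvPolynomial.X_dvd_X.1 h1)
  · apply h
    simp [hl]

lemma IsBubblePoint.exists_stalk_le {R : LocalSubring (RatFun k)} (hR : IsBubblePoint R) :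
    ∃ a : Fin 3 → k, a ≠ 0 ∧ stalkSubring a ≤ R.toSubring := by
  induction hR with
  | proper a ha => exact ⟨a, ha, le_rfl⟩
  | infinitelyNear R hR u v huv P hP ih =>
    obtain ⟨a, ha, h⟩ := ih
    exact ⟨a, ha, h.trans (le_sup_left.trans (LocalSubring.le_ofPrime _ P))⟩

lemma quadPt_basePt (i : Fin 3) : quadPt (basePt i : BubbleSpace k) = basePt i := by
  refine dif_neg fun h => ?_
  obtain ⟨a, ha, hle⟩ := h.exists_stalk_le
  obtain ⟨j, hj⟩ : ∃ j, a j ≠ 0 := Function.ne_iff.1 ha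
  obtain ⟨l, hl, hlj⟩ : ∃ l : Fin 3, l ≠ i ∧ l ≠ j := by
    clear h hle hj; revert i j; decide
  have h1 : (coord l / coord j : RatFun k) ∈ stalkSubring a :=
    ⟨1, _, _, MvPolynomial.isHomogeneous_X _ _, MvPolynomial.isHomogeneous_X _ _,
      by simpa using hj, rfl⟩
  obtain ⟨f, hf, hfe⟩ := hle h1
  apply coord_div_not_mem (k := k) i j l hl hlj
  have h2 : f = coord j / coord l := by
    have h3 : quadAut (quadAut f) = f := congrArg (fun g => g f) quadAut_comp
    have h4 : quadAut f = (coord l / coord j : RatFun k) := hfe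
    rw [← h3, h4, map_div₀, quadAut_coord, quadAut_coord]
    field_simp
  exact h2 ▸ hf

lemma basePt_injective : Function.Injective (basePt (k := k)) := by
  intro i j hij
  by_contra hne
  have h : stalkSubring (Pi.single i (1 : k)) = stalkSubring (Pi.single j (1 : k)) :=
    congrArg (fun q : BubbleSpace k => q.1.toSubring) hij
  refine coord_div_not_mem (k := k) i i j (Ne.symm hne) (Ne.symm hne) ?_
  rw [h]
  exact ⟨1, _, _, MvPolynomial.isHomogeneous_X _ _, MvPolynomial.isHomogeneous_X _ _,
    by simp, rfl⟩

/-- The images of the basis vectors `e_q` under the standard quadratic transformation. -/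
def sigmaE (q : BubbleSpace k) : PicardManin (BubbleSpace k) :=
  open Classical in
  if q = basePt 0 then e₀ - e (basePt 1) - e (basePt 2)
  else if q = basePt 1 then e₀ - e (basePt 0) - e (basePt 2)
  else if q = basePt 2 then e₀ - e (basePt 0) - e (basePt 1)
  else e (quadPt q)

/-- The linear map given by `e₀ ↦ 2e₀ - e_{p₀} - e_{p₁} - e_{p₂}` and the `sigmaE q`. -/
def sigmaLin : PicardManin (BubbleSpace k) →ₗ[ℤ] PicardManin (BubbleSpace k) :=
  LinearMap.coprod
    (LinearMap.toSpanSingleton ℤ _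
      ((2 : ℤ) • e₀ - e (basePt 0) - e (basePt 1) - e (basePt 2)))
    (Finsupp.linearCombination ℤ sigmaE)

lemma sigmaLin_e₀ : sigmaLin (k := k) e₀ =
    (2 : ℤ) • e₀ - e (basePt 0) - e (basePt 1) - e (basePt 2) := by
  simp [sigmaLin, e₀]

lemma sigmaLin_e (q : BubbleSpace k) : sigmaLin (e q) = sigmaE q := by
  simp [sigmaLin, e]

lemma sigmaE_zero : sigmaE (basePt 0 : BubbleSpace k) = e₀ - e (basePt 1) - e (basePt 2) :=
  if_pos rfl

lemma sigmaE_one : sigmaE (basePt 1 : BubbleSpace k) = e₀ - e (basePt 0) - e (basePt 2) := by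
  simp [sigmaE, basePt_injective.eq_iff]

lemma sigmaE_two : sigmaE (basePt 2 : BubbleSpace k) = e₀ - e (basePt 0) - e (basePt 1) := by
  simp [sigmaE, basePt_injective.eq_iff]

lemma sigmaE_of_ne (q : BubbleSpace k) (hq : ∀ i, q ≠ basePt i) : sigmaE q = e (quadPt q) := by
  simp [sigmaE, hq]

lemma sigmaLin_involutive : Function.Involutive (sigmaLin (k := k)) := by
  have h : (sigmaLin (k := k)).comp sigmaLin = LinearMap.id := by
    have h0 : sigmaLin (k := k) (sigmaLin e₀) = e₀ := by
      simp only [sigmaLin_e₀, map_sub, map_smul, sigmaLin_e, sigmaE_zero, sigmaE_one, sigmaE_two]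
      module
    refine LinearMap.prod_ext (LinearMap.ext_ring h0) (Finsupp.lhom_ext' fun q =>
      LinearMap.ext_ring ?_)
    change sigmaLin (sigmaLin (e q)) = e q
    by_cases hq : ∃ i, q = basePt i
    · obtain ⟨i, rfl⟩ := hq
      fin_cases i <;>
        simp only [Fin.zero_eta, Fin.mk_one, Fin.reduceFinMk, sigmaLin_e₀, map_sub, sigmaLin_e,
          sigmaE_zero, sigmaE_one, sigmaE_two] <;> module
    · push Not at hq
      rw [sigmaLin_e, sigmaE_of_ne q hq, sigmaLin_e, sigmaE_of_ne, quadPt_quadPt]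
      intro i hi
      apply hq i
      rw [← quadPt_quadPt q, hi, quadPt_basePt]
  exact fun v => congrArg (fun f => f v) h

/-- The automorphism `σ` of the lattice that is induced by the standard quadratic transformation
`[x : y : z] ⇢ [yz : xz : xy]`. -/
def sigma : PicardManin (BubbleSpace k) ≃ₗ[ℤ] PicardManin (BubbleSpace k) :=
  LinearEquiv.ofInvolutive sigmaLin sigmaLin_involutive

/-! ### The infinite Weyl group -/

variable (k) in
/-- The infinite Weyl group, generated by `Sym` and `σ`. -/
def Weyl : Subgroup (PicardManin (BubbleSpace k) ≃ₗ[ℤ] PicardManin (BubbleSpace k)) :=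
  Subgroup.closure (insert sigma (Sym (BubbleSpace k) : Set _))

/-- The degree `deg f = e₀ · f⁻¹(e₀)` of an element of the Weyl group. -/
def degW (f : Weyl k) : ℤ := deg ((f⁻¹ : Weyl k).1 e₀)

/-- The multiplicity `m_q(f) = e_q · f⁻¹(e₀)` of an element of the Weyl group. -/
def multW (q : BubbleSpace k) (f : Weyl k) : ℤ := mult q ((f⁻¹ : Weyl k).1 e₀)

/-- Jonquières elements of the Weyl group: there is a point `q` with `m_q(f) = deg f - 1`. -/
def IsJonquieres (f : Weyl k) : Prop := ∃ q : BubbleSpace k, multW q f = degW f - 1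

variable (k) in
/-- The orbit of `e₀` under the Weyl group. -/
def orbitE₀ : Set (PicardManin (BubbleSpace k)) := {a | ∃ f : Weyl k, f.1 e₀ = a}

/-- `b` is a predecessor of `a`: it is of minimal degree among the `φ(a)` with `φ` Jonquières. -/
def IsPredecessor (a b : PicardManin (BubbleSpace k)) : Prop :=
  (∃ φ : Weyl k, IsJonquieres φ ∧ b = φ.1 a) ∧
    ∀ φ : Weyl k, IsJonquieres φ → deg b ≤ deg (φ.1 a)

/-- `b` is an `n`-th predecessor of `a`: there are `a = a₀, a₁, …, aₙ = b` such that each `aᵢ₊₁`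
is a predecessor of `aᵢ`. -/
def IsNthPredecessor : ℕ → PicardManin (BubbleSpace k) → PicardManin (BubbleSpace k) → Prop
  | 0, a, b => b = a
  | n + 1, a, b => ∃ c, IsNthPredecessor n a c ∧ IsPredecessor c b

/-- The composition `ψₙ ∘ ⋯ ∘ ψ₁`. -/
def compUpTo (ψ : ℕ → Weyl k) : ℕ → Weyl k
  | 0 => 1
  | n + 1 => ψ (n + 1) * compUpTo ψ n

end Bubble

end Cremona

namespace Cremona

/-! ### Bilinearity of the form, basis vectors, the canonical class -/

section Lattice

variable {B : Type*}

/-! Write ℓ_q = e₀ - e_q (`pencil q`), so that v·ℓ_q = deg v - m_q(v) and comult v is the minimum of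
these numbers over q. A root is a vector of square -2 orthogonal to the canonical class. By
integrality, a root β of positive degree satisfies β·ℓ_q ≥ 0 for every q. Hence the reflection s_β,
applied to u with u·β ≥ 0, lowers neither the degree nor the comultiplicity, and it raises the
degree unless it fixes u. The order `BruhatLE` generated by these moves and by Sym therefore implies
all three assertions (`BruhatLE.le`), and it suffices to show aₙ ≤ bₙ in it.

The Jonquières elements are the f in W that send some ℓ_q (q is a center of f) to some ℓ_q'. Two
facts about them, modelled on Coxeter groups, carry the proof.

Minimality (`IsPredecessor.bruhatLE`): a predecessor of v lies below ψ(v) for every Jonquières ψ.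
Transpositions move the center to a point of larger multiplicity; for a fixed center q, an element
minimizing the degree is joined to any other one by reflections in roots orthogonal to ℓ_q, each of
them a step of the order.

Lifting (`bruhatLE_apply_of_step`): let w = s_β(u) be a step up and ψ Jonquières with center q. If
deg ψ(β) ≥ 0, then ψ(u) ≤ ψ(w). Otherwise β·ℓ_q = 0, so ψ s_β is again Jonquières and ψ(w) = (ψ
s_β)(u). Thus a lower bound for all Jonquières images of u is one for those of w, and induction on n
concludes. -/

lemma inter_eq_sum (a b : PicardManin B) {s : Finset B} (hs : a.2.support ⊆ s) :
    inter a b = a.1 * b.1 - ∑ p ∈ s, a.2 p * b.2 p := by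
  rw [inter, Finsupp.sum_of_support_subset _ hs _ (by simp)]

lemma inter_comm (a b : PicardManin B) : inter a b = inter b a := by
  classical
  rw [inter_eq_sum a b (Finset.subset_union_left (s₂ := b.2.support)),
    inter_eq_sum b a (Finset.subset_union_right (s₁ := a.2.support))]
  simp only [mul_comm]

lemma inter_add_left (a b c : PicardManin B) : inter (a + b) c = inter a c + inter b c := by
  simp only [inter, Prod.fst_add, Prod.snd_add]
  rw [Finsupp.sum_add_index' (by simp) (by intros; ring)]
  ring

lemma inter_add_right (a b c : PicardManin B) : inter a (b + c) = inter a b + inter a c := by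
  rw [inter_comm, inter_add_left, inter_comm b, inter_comm c]

lemma inter_smul_left (n : ℤ) (a c : PicardManin B) : inter (n • a) c = n * inter a c := by
  simp only [inter, Prod.smul_fst, Prod.smul_snd, smul_eq_mul]
  rw [Finsupp.sum_smul_index (by simp), mul_sub, Finsupp.mul_sum]
  simp only [mul_assoc]

lemma inter_smul_right (n : ℤ) (a c : PicardManin B) : inter a (n • c) = n * inter a c := by
  rw [inter_comm, inter_smul_left, inter_comm]

lemma inter_neg_left (a c : PicardManin B) : inter (-a) c = -inter a c := by
  rw [← neg_one_smul ℤ, inter_smul_left]; ring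

lemma inter_neg_right (a c : PicardManin B) : inter a (-c) = -inter a c := by
  rw [inter_comm, inter_neg_left, inter_comm]

lemma inter_sub_left (a b c : PicardManin B) : inter (a - b) c = inter a c - inter b c := by
  rw [sub_eq_add_neg, inter_add_left, inter_neg_left, sub_eq_add_neg]

lemma inter_sub_right (a b c : PicardManin B) : inter a (b - c) = inter a b - inter a c := by
  rw [inter_comm, inter_sub_left, inter_comm b, inter_comm c]

lemma inter_e₀_left (a : PicardManin B) : inter e₀ a = a.1 := by simp [inter, e₀]

lemma inter_e₀_right (a : PicardManin B) : inter a e₀ = a.1 := by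
  rw [inter_comm, inter_e₀_left]

lemma inter_e_left (p : B) (a : PicardManin B) : inter (e p) a = -a.2 p := by
  simp [inter, e]

lemma inter_e_right (p : B) (a : PicardManin B) : inter a (e p) = -a.2 p := by
  rw [inter_comm, inter_e_left]

lemma deg_eq (a : PicardManin B) : deg a = a.1 := inter_e₀_left a

@[simp] lemma e₀_fst : (e₀ : PicardManin B).1 = 1 := rfl

@[simp] lemma e₀_snd : (e₀ : PicardManin B).2 = 0 := rfl

@[simp] lemma e_fst (p : B) : (e p).1 = 0 := rfl

@[simp] lemma e_snd_self (p : B) : (e p).2 p = 1 := by simp [e]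

lemma e_snd_of_ne {p q : B} (h : q ≠ p) : (e p).2 q = 0 := by
  simp [e, h.symm]

lemma e_injective : Function.Injective (e : B → PicardManin B) := by
  intro p q h
  by_contra hne
  have h1 := congrArg (fun v : PicardManin B => v.2 p) h
  simp [e_snd_of_ne hne] at h1

/-- The product with the anticanonical class: `3 deg a - ∑ m_q(a)`. -/
def anticanonical : PicardManin B →ₗ[ℤ] ℤ :=
  LinearMap.coprod (LinearMap.toSpanSingleton ℤ ℤ 3) (Finsupp.linearCombination ℤ fun _ => 1)

lemma anticanonical_apply (a : PicardManin B) :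
    anticanonical a = 3 * a.1 + a.2.sum fun _ m => m := by
  simp [anticanonical, Finsupp.linearCombination_apply, mul_comm]

@[simp] lemma anticanonical_e₀ : anticanonical (e₀ : PicardManin B) = 3 := by
  simp [anticanonical, e₀]

@[simp] lemma anticanonical_e (p : B) : anticanonical (e p) = 1 := by
  simp [anticanonical, e]

lemma PicardManin.linearMap_ext {M : Type*} [AddCommGroup M] {f g : PicardManin B →ₗ[ℤ] M}
    (h0 : f e₀ = g e₀) (h : ∀ p, f (e p) = g (e p)) : f = g :=
  LinearMap.prod_ext (LinearMap.ext_ring h0)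
    (Finsupp.lhom_ext' fun p => LinearMap.ext_ring (h p))

/-! ### Small vectors -/

lemma sq_snd_le (v : PicardManin B) (q : B) : v.2 q ^ 2 ≤ v.1 ^ 2 - inter v v := by
  classical
  rw [inter_eq_sum v v (Finset.subset_insert q v.2.support)]
  have := Finset.single_le_sum (f := fun p => v.2 p * v.2 p) (fun p _ => mul_self_nonneg (v.2 p))
    (Finset.mem_insert_self q v.2.support)
  nlinarith

/-- Integers satisfy m ≤ m². Equality forces m to be 0 or 1, which is what makes small vectors
recognizable below. -/
lemma anticanonical_le {z : PicardManin B} (h0 : z.1 = 0) : anticanonical z ≤ -inter z z := by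
  rw [anticanonical_apply, inter_eq_sum z z subset_rfl, h0, Finsupp.sum]
  have : ∑ p ∈ z.2.support, z.2 p ≤ ∑ p ∈ z.2.support, z.2 p * z.2 p :=
    Finset.sum_le_sum fun p _ => by nlinarith [Int.le_self_sq (z.2 p)]
  linarith

lemma sum_e_fst (S : Finset B) : (∑ p ∈ S, e p).1 = 0 := by
  simp [Prod.fst_sum]

lemma sum_e_snd [DecidableEq B] (S : Finset B) (q : B) :
    (∑ p ∈ S, e p).2 q = if q ∈ S then 1 else 0 := by
  simp [Prod.snd_sum, e, Finsupp.single_apply]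

/-- A vector of degree `0` for which `∑ m_q² = -∑ m_q` is a sum of different `e_p`. -/
lemma exists_eq_sum_e {z : PicardManin B} (h0 : z.1 = 0) (h : anticanonical z = -inter z z) :
    ∃ S : Finset B, z = ∑ p ∈ S, e p ∧ anticanonical z = S.card := by
  classical
  have hz : z = ∑ p ∈ z.2.support, e p := by
    rw [anticanonical_apply, inter_eq_sum z z subset_rfl, h0, Finsupp.sum] at h
    have h1 : ∑ p ∈ z.2.support, (z.2 p * z.2 p - z.2 p) = 0 := by
      rw [Finset.sum_sub_distrib]; linarith
    rw [Finset.sum_eq_zero_iff_of_nonneg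
      fun p _ => by nlinarith [Int.le_self_sq (z.2 p)]] at h1
    refine Prod.ext (by rw [sum_e_fst, h0]) (Finsupp.ext fun p => ?_)
    rw [sum_e_snd]
    split_ifs with hp
    · have h2 := h1 p hp
      have h3 : z.2 p ≠ 0 := by simpa using hp
      exact mul_left_cancel₀ h3 (by linarith)
    · simpa using hp
  refine ⟨_, hz, ?_⟩
  conv_lhs => rw [hz]
  simp

lemma exists_eq_e {z : PicardManin B} (h0 : z.1 = 0) (h : anticanonical z = 1)
    (h' : inter z z = -1) : ∃ p, z = e p := by
  obtain ⟨S, hS, hc⟩ := exists_eq_sum_e h0 (by rw [h, h']; norm_num)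
  obtain ⟨p, rfl⟩ := Finset.card_eq_one.1 (by exact_mod_cast hc.symm.trans h : S.card = 1)
  exact ⟨p, by simpa using hS⟩

/-! ### Roots and reflections -/

/-- The vectors of square `-2` orthogonal to the canonical class. -/
structure IsRoot (β : PicardManin B) : Prop where
  inter_self : inter β β = -2
  anticanonical_eq : anticanonical β = 0

lemma IsRoot.neg {β : PicardManin B} (h : IsRoot β) : IsRoot (-β) :=
  ⟨by rw [inter_neg_left, inter_neg_right, neg_neg, h.1], by rw [map_neg, h.2, neg_zero]⟩

lemma isRoot_sub {p q : B} (h : p ≠ q) : IsRoot (e p - e q) := by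
  refine ⟨?_, by simp⟩
  simp [inter_sub_left, inter_e_left, e_snd_of_ne h, e_snd_of_ne h.symm]

lemma isRoot_e₀_sub {p q r : B} (hpq : p ≠ q) (hpr : p ≠ r) (hqr : q ≠ r) :
    IsRoot (e₀ - e p - e q - e r) := by
  refine ⟨?_, by simp⟩
  simp [inter_sub_left, inter_e_left, inter_e₀_left, e_snd_of_ne hpq, e_snd_of_ne hpr,
    e_snd_of_ne hqr, e_snd_of_ne hpq.symm, e_snd_of_ne hpr.symm, e_snd_of_ne hqr.symm]

/-- The linear map `v ↦ v + (v · β) β`, a reflection if `β² = -2`. -/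
def reflLin (β : PicardManin B) : PicardManin B →ₗ[ℤ] PicardManin B where
  toFun v := v + inter v β • β
  map_add' u v := by rw [inter_add_left]; module
  map_smul' n v := by rw [inter_smul_left, RingHom.id_apply]; module

lemma reflLin_apply (β v : PicardManin B) : reflLin β v = v + inter v β • β := rfl

lemma IsRoot.involutive {β : PicardManin B} (h : IsRoot β) : Function.Involutive (reflLin β) := by
  intro v
  simp only [reflLin_apply, inter_add_left, inter_smul_left, h.1]
  module

/-- The reflection in a root. -/
def IsRoot.refl {β : PicardManin B} (h : IsRoot β) : PicardManin B ≃ₗ[ℤ] PicardManin B :=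
  LinearEquiv.ofInvolutive (reflLin β) h.involutive

lemma IsRoot.refl_apply {β : PicardManin B} (h : IsRoot β) (v : PicardManin B) :
    h.refl v = v + inter v β • β := rfl

lemma IsRoot.refl_refl {β : PicardManin B} (h : IsRoot β) (v : PicardManin B) :
    h.refl (h.refl v) = v := h.involutive v

/-! ### Isometries preserving the canonical class -/

/-- The linear automorphisms which preserve the intersection form and the canonical class. -/
structure IsCanonicalIsometry (f : PicardManin B ≃ₗ[ℤ] PicardManin B) : Prop where
  inter_map : ∀ u v, inter (f u) (f v) = inter u v
  anticanonical_map : ∀ v, anticanonical (f v) = anticanonical v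

namespace IsCanonicalIsometry

variable {f g : PicardManin B ≃ₗ[ℤ] PicardManin B}

lemma one : IsCanonicalIsometry (1 : PicardManin B ≃ₗ[ℤ] PicardManin B) :=
  ⟨fun _ _ => rfl, fun _ => rfl⟩

lemma mul (hf : IsCanonicalIsometry f) (hg : IsCanonicalIsometry g) :
    IsCanonicalIsometry (f * g) :=
  ⟨fun u v => by rw [LinearEquiv.mul_apply, LinearEquiv.mul_apply, hf.1, hg.1],
    fun v => by rw [LinearEquiv.mul_apply, hf.2, hg.2]⟩

lemma inv (hf : IsCanonicalIsometry f) : IsCanonicalIsometry f⁻¹ := by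
  have h : ∀ v, f (f⁻¹ v) = v := fun v => f.apply_symm_apply v
  exact ⟨fun u v => by rw [← hf.1, h, h], fun v => by rw [← hf.2, h]⟩

lemma inter_inv_left (hf : IsCanonicalIsometry f) (u v : PicardManin B) :
    inter (f⁻¹ u) v = inter u (f v) := by
  rw [← hf.1, show f (f⁻¹ u) = u from f.apply_symm_apply u]

lemma isRoot (hf : IsCanonicalIsometry f) {β : PicardManin B} (h : IsRoot β) : IsRoot (f β) :=
  ⟨by rw [hf.1, h.1], by rw [hf.2, h.2]⟩

lemma map_refl (hf : IsCanonicalIsometry f) {β : PicardManin B} (h : IsRoot β)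
    (v : PicardManin B) : f (h.refl v) = (hf.isRoot h).refl (f v) := by
  rw [h.refl_apply, IsRoot.refl_apply, hf.1, map_add, map_smul]

end IsCanonicalIsometry

lemma IsRoot.isCanonicalIsometry {β : PicardManin B} (h : IsRoot β) :
    IsCanonicalIsometry h.refl := by
  refine ⟨fun u v => ?_, fun v => ?_⟩
  · simp only [h.refl_apply, inter_add_left, inter_add_right, inter_smul_left, inter_smul_right,
      h.1, inter_comm β v]
    ring
  · rw [h.refl_apply, map_add, map_smul, h.2, smul_zero, add_zero]

lemma isCanonicalIsometry_of_mem_sym {f : PicardManin B ≃ₗ[ℤ] PicardManin B} (hf : f ∈ Sym B) :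
    IsCanonicalIsometry f := by
  obtain ⟨h0, t, ht⟩ := hf
  have hv : ∀ v, (f v).1 = v.1 ∧ ∀ p, (f v).2 (t p) = v.2 p := by
    intro v
    induction' v using Prod.rec with d x
    have h1 : ((d, x) : PicardManin B) = d • e₀ + (0, x) := by simp [e₀]
    rw [h1, map_add, map_smul, h0]
    suffices h : (f (0, x)).1 = 0 ∧ ∀ p, (f (0, x)).2 (t p) = x p by
      simpa [e₀] using h
    clear h1
    induction x using Finsupp.induction_linear with
    | zero =>
      have : f (0, 0) = 0 := map_zero f
      simp [this]
    | add x y hx hy =>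
      have : ((0, x + y) : PicardManin B) = (0, x) + (0, y) := by simp
      rw [this, map_add]
      exact ⟨by simp [hx.1, hy.1], fun p => by simp [hx.2, hy.2]⟩
    | single q m =>
      have : ((0, Finsupp.single q m) : PicardManin B) = m • e q := by simp [e]
      rw [this, map_smul, ht]
      classical
      exact ⟨by simp [e], fun p => by simp [e, Finsupp.single_apply]⟩
  have hs : ∀ v, (f v).2.support = v.2.support.map t.toEmbedding := by
    intro v
    ext p
    obtain ⟨q, rfl⟩ := t.surjective p
    simp [(hv v).2]
  refine ⟨fun u v => ?_, fun v => ?_⟩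
  · rw [inter_eq_sum _ _ subset_rfl, inter_eq_sum _ _ subset_rfl, hs, Finset.sum_map]
    simp [hv]
  · rw [anticanonical_apply, anticanonical_apply, Finsupp.sum, Finsupp.sum, hs, Finset.sum_map]
    simp [hv]

/-- The stabilizer of `e₀` is `Sym`. -/
lemma IsCanonicalIsometry.mem_sym {f : PicardManin B ≃ₗ[ℤ] PicardManin B}
    (hf : IsCanonicalIsometry f) (h0 : f e₀ = e₀) : f ∈ Sym B := by
  -- Since g fixes e₀, the vector g(e_p) keeps degree 0, anticanonical degree 1 and square -1, so it
  -- is some e_q. Using this for f and f⁻¹ gives a permutation.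
  have key : ∀ g : PicardManin B ≃ₗ[ℤ] PicardManin B, IsCanonicalIsometry g → g e₀ = e₀ →
      ∀ p, ∃ q, g (e p) = e q := by
    intro g hg hg0 p
    refine exists_eq_e ?_ ?_ ?_
    · rw [← inter_e₀_left, ← hg0, hg.1, inter_e₀_left, e_fst]
    · rw [hg.2, anticanonical_e]
    · rw [hg.1, inter_e_left, e_snd_self]
  choose t ht using key f hf h0
  choose s hs using key f⁻¹ hf.inv ((LinearEquiv.symm_apply_eq f).2 h0.symm)
  refine ⟨h0, ⟨t, s, fun p => e_injective ?_, fun p => e_injective ?_⟩, ht⟩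
  · rw [← hs, ← ht]; exact f.symm_apply_apply _
  · rw [← ht, ← hs]; exact f.apply_symm_apply _

/-- The element of `Sym` given by a permutation. -/
def permMap (t : Equiv.Perm B) : PicardManin B ≃ₗ[ℤ] PicardManin B :=
  (LinearEquiv.refl ℤ ℤ).prodCongr (Finsupp.domLCongr t)

lemma permMap_e₀ (t : Equiv.Perm B) : permMap t e₀ = e₀ := by
  simp [permMap, e₀]

lemma permMap_e (t : Equiv.Perm B) (p : B) : permMap t (e p) = e (t p) := by
  simp [permMap, e]

lemma permMap_mem (t : Equiv.Perm B) : permMap t ∈ Sym B := ⟨permMap_e₀ t, t, permMap_e t⟩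

lemma isRoot_sub_refl_mem {p q : B} (h : p ≠ q) : (isRoot_sub h).refl ∈ Sym B := by
  refine (isRoot_sub h).isCanonicalIsometry.mem_sym ?_
  rw [IsRoot.refl_apply, inter_e₀_left]
  simp

/-! ### Pencils of lines and the roots orthogonal to them -/

/-- The class `e₀ - e_q` of the lines through `q`. -/
def pencil (q : B) : PicardManin B := e₀ - e q

lemma inter_pencil (v : PicardManin B) (q : B) : inter v (pencil q) = v.1 + v.2 q := by
  rw [pencil, inter_sub_right, inter_e₀_right, inter_e_right]; ring

/-- The vector e₀ - v has degree 0, anticanonical degree 1 and square -1. -/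
lemma exists_eq_pencil {v : PicardManin B} (h0 : v.1 = 1) (h : anticanonical v = 2)
    (h' : inter v v = 0) : ∃ q, v = pencil q := by
  obtain ⟨q, hq⟩ := exists_eq_e (z := e₀ - v) (by simp [h0]) (by simp [h])
    (by simp [inter_sub_left, inter_sub_right, inter_e₀_left, inter_e₀_right, h0, h'])
  exact ⟨q, by rw [pencil, ← hq]; abel⟩

/-- With d = deg β ≥ 1, the bound m_q² ≤ d² + 2 excludes m_q ≥ d + 1. -/
lemma IsRoot.inter_pencil_nonneg {β : PicardManin B} (h : IsRoot β) (hd : 0 < β.1) (q : B) :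
    0 ≤ inter β (pencil q) := by
  have := sq_snd_le β q
  rw [h.1] at this
  rw [inter_pencil]
  nlinarith

/-- The reflection in a root of degree `0` is a transposition of two points. -/
lemma IsRoot.refl_mem_sym {β : PicardManin B} (h : IsRoot β) (hd : β.1 = 0) :
    h.refl ∈ Sym B := by
  refine h.isCanonicalIsometry.mem_sym ?_
  rw [h.refl_apply, inter_e₀_left, hd]
  simp

/-- The roots of positive degree orthogonal to the class of the lines through `q`. -/
lemma IsRoot.eq_of_inter_pencil {β : PicardManin B} (h : IsRoot β) (hd : 0 < β.1) {q : B}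
    (hq : inter β (pencil q) = 0) :
    ∃ p r, p ≠ q ∧ r ≠ q ∧ p ≠ r ∧ β = e₀ - e q - e p - e r := by
  classical
  rw [inter_pencil] at hq
  have hq' : β.2 q = -β.1 := by linarith
  -- This z has degree 0, anticanonical degree 2d and square -2. So 2d ≤ 2, hence d = 1, and the
  -- resulting equality makes z a sum of two different e_p.
  set z : PicardManin B := β.1 • pencil q - β with hz
  have h0 : z.1 = 0 := by simp [hz, pencil]
  have h1 : anticanonical z = 2 * β.1 := by simp [hz, pencil, h.2]; ring
  have h2 : inter z z = -2 := by
    have h3 : inter (pencil q) (pencil q) = 0 := by simp [inter_pencil]; simp [pencil]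
    have h4 : inter β (pencil q) = 0 := by rw [inter_pencil, hq]
    simp [hz, inter_sub_left, inter_sub_right, inter_smul_left, inter_smul_right, h3, h4,
      inter_comm (pencil q) β, h.1]
  have hle := anticanonical_le h0
  have hd1 : β.1 = 1 := by omega
  obtain ⟨S, hS, hc⟩ := exists_eq_sum_e h0 (by rw [h1, h2, hd1]; norm_num)
  obtain ⟨p, r, hpr, rfl⟩ := Finset.card_eq_two.1 (by zify; rw [← hc, h1, hd1]; rfl : S.card = 2)
  have hzq : z.2 q = 0 := by simp [hz, pencil, hq']
  rw [hS, sum_e_snd] at hzq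
  have hq2 : q ≠ p ∧ q ≠ r := by simpa using hzq
  refine ⟨p, r, hq2.1.symm, hq2.2.symm, hpr, ?_⟩
  rw [Finset.sum_pair hpr] at hS
  have : β = β.1 • pencil q - z := by rw [hz]; abel
  rw [this, hS, hd1, pencil]
  module

/-! ### An order on the lattice -/

/-- The elementary relations of the order `BruhatLE`. -/
def BruhatStep (u v : PicardManin B) : Prop :=
  EqModSym u v ∨ ∃ β, ∃ h : IsRoot β, 0 < β.1 ∧ 0 ≤ inter u β ∧ v = h.refl u

/-- An analogue of the Bruhat order, modulo `Sym`: it is generated by the reflections in roots of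
positive degree which increase the degree. -/
def BruhatLE : PicardManin B → PicardManin B → Prop := Relation.ReflTransGen BruhatStep

lemma EqModSym.symm {u v : PicardManin B} : EqModSym u v → EqModSym v u := by
  rintro ⟨f, hf, rfl⟩
  exact ⟨f⁻¹, inv_mem hf, (f.symm_apply_apply u).symm⟩

lemma EqModSym.trans {u v w : PicardManin B} : EqModSym u v → EqModSym v w → EqModSym u w := by
  rintro ⟨f, hf, rfl⟩ ⟨g, hg, rfl⟩
  exact ⟨g * f, mul_mem hg hf, rfl⟩

lemma EqModSym.bruhatLE {u v : PicardManin B} (h : EqModSym u v) : BruhatLE u v :=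
  .single (.inl h)

lemma mem_sym_fst {f : PicardManin B ≃ₗ[ℤ] PicardManin B} (hf : f ∈ Sym B) (v : PicardManin B) :
    (f v).1 = v.1 := by
  rw [← inter_e₀_left, ← hf.1, (isCanonicalIsometry_of_mem_sym hf).1, inter_e₀_left]

lemma comult_le [Nonempty B] (u : PicardManin B) (q : B) : comult u ≤ inter u (pencil q) := by
  have := (isGreatest_maxMult u).2 ⟨q, rfl⟩
  simp only [mult_eq] at this
  rw [comult, deg_eq, inter_pencil]
  linarith

lemma exists_comult_eq [Nonempty B] (u : PicardManin B) :
    ∃ q, comult u = inter u (pencil q) := by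
  obtain ⟨q, hq⟩ := (isGreatest_maxMult u).1
  simp only [mult_eq] at hq
  exact ⟨q, by rw [comult, deg_eq, inter_pencil]; linarith⟩

/-- For a reflection step and q attaining comult v, comult u ≤ u·ℓ_q ≤ v·ℓ_q = comult v. The degree
changes by (u·β) deg β, which vanishes only if u·β = 0. -/
lemma BruhatStep.le [Nonempty B] {u v : PicardManin B} (h : BruhatStep u v) :
    u.1 ≤ v.1 ∧ comult u ≤ comult v ∧ (u.1 = v.1 → EqModSym u v) := by
  obtain ⟨q, hq⟩ := exists_comult_eq v
  rcases h with ⟨f, hf, rfl⟩ | ⟨β, h, hd, hu, rfl⟩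
  · refine ⟨(mem_sym_fst hf u).ge, ?_, fun _ => ⟨f, hf, rfl⟩⟩
    obtain ⟨h0, t, ht⟩ := id hf
    have hp : pencil q = f (pencil (t.symm q)) := by
      rw [pencil, pencil, map_sub, h0, ht, Equiv.apply_symm_apply]
    rw [hq, hp, (isCanonicalIsometry_of_mem_sym hf).1]
    exact comult_le _ _
  · have h1 := h.inter_pencil_nonneg hd q
    refine ⟨?_, ?_, fun h2 => ?_⟩
    · rw [h.refl_apply, Prod.fst_add, Prod.smul_fst, smul_eq_mul]
      nlinarith
    · rw [hq, h.refl_apply, inter_add_left, inter_smul_left]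
      nlinarith [comult_le u q]
    · rw [h.refl_apply, Prod.fst_add, Prod.smul_fst, smul_eq_mul] at h2
      have h3 : inter u β = 0 := by
        rcases mul_eq_zero.1 (by linarith : inter u β * β.1 = 0) with h4 | h4
        · exact h4
        · omega
      exact ⟨1, one_mem _, by rw [h.refl_apply, h3]; simp⟩

lemma BruhatLE.le [Nonempty B] {u v : PicardManin B} (h : BruhatLE u v) :
    u.1 ≤ v.1 ∧ comult u ≤ comult v ∧ (u.1 = v.1 → EqModSym u v) := by
  induction h with
  | refl => exact ⟨le_rfl, le_rfl, fun _ => ⟨1, one_mem _, rfl⟩⟩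
  | tail _ h ih =>
    obtain ⟨h1, h2, h3⟩ := h.le
    exact ⟨ih.1.trans h1, ih.2.1.trans h2,
      fun he => (ih.2.2 (by omega)).trans (h3 (by omega))⟩

/-- Conjugation by f turns s_β into the reflection in f(β). Degree 0 is allowed, because that
reflection is then in Sym. -/
lemma IsCanonicalIsometry.bruhatLE_refl {f : PicardManin B ≃ₗ[ℤ] PicardManin B}
    (hf : IsCanonicalIsometry f) {β v : PicardManin B} (h : IsRoot β) (hd : 0 ≤ (f β).1)
    (hv : 0 ≤ inter v β) : BruhatLE (f v) (f (h.refl v)) := by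
  rw [hf.map_refl h]
  rcases hd.eq_or_lt with hd | hd
  · exact EqModSym.bruhatLE ⟨_, (hf.isRoot h).refl_mem_sym hd.symm, rfl⟩
  · exact .single (.inr ⟨_, hf.isRoot h, hd, by rwa [hf.1], rfl⟩)

lemma IsCanonicalIsometry.refl_bruhatLE {f : PicardManin B ≃ₗ[ℤ] PicardManin B}
    (hf : IsCanonicalIsometry f) {β v : PicardManin B} (h : IsRoot β) (hd : 0 ≤ (f β).1)
    (hv : inter v β ≤ 0) : BruhatLE (f (h.refl v)) (f v) := by
  have h1 := hf.bruhatLE_refl (v := h.refl v) h hd (by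
    rw [h.refl_apply, inter_add_left, inter_smul_left, h.1]; linarith)
  rwa [h.refl_refl] at h1

end Lattice

/-! ### The Weyl group and its reflections -/

section Weyl

variable {k : Type*} [Field k]

instance : Nonempty (BubbleSpace k) := ⟨basePt 0⟩

lemma basePt_ne {i j : Fin 3} (h : i ≠ j) : (basePt i : BubbleSpace k) ≠ basePt j :=
  basePt_injective.ne h

/-- The permutation of the bubble space induced by the standard quadratic transformation. -/
def quadPerm : Equiv.Perm (BubbleSpace k) := ⟨quadPt, quadPt, quadPt_quadPt, quadPt_quadPt⟩

lemma quadPerm_apply (q : BubbleSpace k) : quadPerm q = quadPt q := rfl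

/-- `σ` is the composition of a reflection and an element of `Sym`. -/
lemma sigma_eq {h : IsRoot (e₀ - e (basePt 0 : BubbleSpace k) - e (basePt 1) - e (basePt 2))} :
    sigma = permMap quadPerm * h.refl := by
  have h01 := basePt_ne (k := k) (i := 0) (j := 1) (by decide)
  have h02 := basePt_ne (k := k) (i := 0) (j := 2) (by decide)
  have h12 := basePt_ne (k := k) (i := 1) (j := 2) (by decide)
  apply LinearEquiv.toLinearMap_injective
  refine PicardManin.linearMap_ext ?_ fun q => ?_
  -- The convention that `quadPt` fixes the three base points makes the permutation trivial on the
  -- root.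
  · change sigmaLin e₀ = permMap _ (h.refl e₀)
    rw [h.refl_apply, inter_e₀_left, sigmaLin_e₀]
    simp only [map_add, map_smul, map_sub, permMap_e₀, permMap_e,
      quadPerm_apply, quadPt_basePt]
    simp
    module
  · change sigmaLin (e q) = permMap _ (h.refl (e q))
    rw [h.refl_apply, inter_e_left, sigmaLin_e]
    simp only [map_add, map_smul, map_sub, permMap_e₀, permMap_e,
      quadPerm_apply, quadPt_basePt]
    by_cases hq : ∃ i, q = basePt i
    · obtain ⟨i, rfl⟩ := hq
      rw [quadPt_basePt]
      fin_cases i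
      · simp [sigmaE_zero, e_snd_of_ne h01, e_snd_of_ne h02]
        abel
      · simp [sigmaE_one, e_snd_of_ne h01.symm, e_snd_of_ne h12]
        abel
      · simp [sigmaE_two, e_snd_of_ne h02.symm, e_snd_of_ne h12.symm]
    · push Not at hq
      rw [sigmaE_of_ne q hq]
      simp [e_snd_of_ne (hq _)]

lemma isRoot_basePt :
    IsRoot (e₀ - e (basePt 0 : BubbleSpace k) - e (basePt 1) - e (basePt 2)) :=
  isRoot_e₀_sub (basePt_ne (by decide)) (basePt_ne (by decide)) (basePt_ne (by decide))

lemma sym_le_weyl : Sym (BubbleSpace k) ≤ Weyl k := fun _ hf =>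
  Subgroup.subset_closure (Set.mem_insert_of_mem _ hf)

lemma isCanonicalIsometry_of_mem_weyl {f : PicardManin (BubbleSpace k) ≃ₗ[ℤ] _}
    (hf : f ∈ Weyl k) : IsCanonicalIsometry f := by
  induction hf using Subgroup.closure_induction with
  | mem f hf =>
    rcases hf with rfl | hf
    · rw [sigma_eq (h := isRoot_basePt)]
      exact (isCanonicalIsometry_of_mem_sym (permMap_mem _)).mul isRoot_basePt.isCanonicalIsometry
    · exact isCanonicalIsometry_of_mem_sym hf
  | one => exact .one
  | mul f g _ _ hf hg => exact hf.mul hg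
  | inv f _ hf => exact hf.inv

lemma weylIsometry (f : Weyl k) : IsCanonicalIsometry f.1 := isCanonicalIsometry_of_mem_weyl f.2

lemma refl_mem_weyl_of_eq {p q r : BubbleSpace k} (hpq : p ≠ q) (hpr : p ≠ r) (hqr : q ≠ r)
    {β : PicardManin (BubbleSpace k)} (h : IsRoot β) (hβ : β = e₀ - e p - e q - e r) :
    h.refl ∈ Weyl k := by
  have hinj : Function.Injective ![p, q, r] := by
    intro i j
    fin_cases i <;> fin_cases j <;> simp [hpq, hpr, hqr, hpq.symm, hpr.symm, hqr.symm]
  -- Permutations act transitively on triples of different points, so the reflection is conjugate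
  -- under Sym to the one contained in σ.
  have := Equiv.Perm.isMultiplyPretransitive (BubbleSpace k) 3
  obtain ⟨t, ht⟩ := MulAction.exists_smul_eq
    (Equiv.Perm (BubbleSpace k)) (⟨basePt, basePt_injective⟩ : Fin 3 ↪ BubbleSpace k)
    ⟨![p, q, r], hinj⟩
  have ht' : ∀ i, t (basePt i) = ![p, q, r] i := fun i => DFunLike.congr_fun ht i
  have h0 : t (basePt 0) = p := ht' 0
  have h1 : t (basePt 1) = q := ht' 1
  have h2 : t (basePt 2) = r := ht' 2
  have hmem : (isRoot_basePt (k := k)).refl ∈ Weyl k := by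
    have hs : sigma (k := k) ∈ Weyl k := Subgroup.subset_closure (Set.mem_insert _ _)
    rw [sigma_eq (h := isRoot_basePt)] at hs
    exact (Subgroup.mul_mem_cancel_left _ (sym_le_weyl (permMap_mem _))).1 hs
  have ht := sym_le_weyl (permMap_mem t)
  convert mul_mem (mul_mem ht hmem) (inv_mem ht)
  refine LinearEquiv.ext fun v => ?_
  obtain ⟨w, rfl⟩ := (permMap t).surjective v
  have hw : (permMap t)⁻¹ (permMap t w) = w := (permMap t).symm_apply_apply w
  rw [LinearEquiv.mul_apply, LinearEquiv.mul_apply, hw,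
    (isCanonicalIsometry_of_mem_sym (permMap_mem t)).map_refl isRoot_basePt]
  simp only [IsRoot.refl_apply, map_sub, permMap_e₀, permMap_e, h0, h1, h2, hβ]

/-- Up to sign, a root orthogonal to ℓ_q has degree 0 or is e₀ - e_q - e_p - e_r. -/
lemma refl_mem_weyl {β : PicardManin (BubbleSpace k)} (h : IsRoot β) {q : BubbleSpace k}
    (hq : inter β (pencil q) = 0) : h.refl ∈ Weyl k := by
  rcases lt_trichotomy β.1 0 with hd | hd | hd
  · obtain ⟨p, r, hp, hr, hpr, hβ⟩ := h.neg.eq_of_inter_pencil (by simpa using hd)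
      (by rw [inter_neg_left, hq, neg_zero])
    convert refl_mem_weyl_of_eq hp.symm hr.symm hpr h.neg hβ using 1
    refine LinearEquiv.ext fun v => ?_
    rw [IsRoot.refl_apply, IsRoot.refl_apply, inter_neg_right]
    module
  · exact sym_le_weyl (h.refl_mem_sym hd)
  · obtain ⟨p, r, hp, hr, hpr, hβ⟩ := h.eq_of_inter_pencil hd hq
    exact refl_mem_weyl_of_eq hp.symm hr.symm hpr h hβ

/-! ### Jonquières elements -/

/-- The Jonquières elements with a given base point `q` of maximal multiplicity. -/
def HasCenter (f : Weyl k) (q : BubbleSpace k) : Prop := (f.1 (pencil q)).1 = 1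

lemma weyl_fst_apply (f : Weyl k) (v : PicardManin (BubbleSpace k)) :
    (f.1 v).1 = inter (f.1⁻¹ e₀) v := by
  rw [(weylIsometry f).inter_inv_left, inter_e₀_left]

/-- By isometry, deg f(ℓ_q) = f⁻¹(e₀)·ℓ_q = deg f - m_q(f). -/
lemma isJonquieres_iff (f : Weyl k) : IsJonquieres f ↔ ∃ q, HasCenter f q := by
  refine exists_congr fun q => ?_
  rw [HasCenter, weyl_fst_apply f, inter_pencil, multW, degW, mult_eq, deg_eq]
  change _ = (f.1⁻¹ e₀).1 - 1 ↔ _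
  change -(f.1⁻¹ e₀).2 q = _ ↔ _
  constructor <;> intro h <;> linarith

lemma HasCenter.exists_eq_pencil {f : Weyl k} {q : BubbleSpace k} (h : HasCenter f q) :
    ∃ q', f.1 (pencil q) = pencil q' := by
  refine Cremona.exists_eq_pencil h ?_ ?_
  · rw [(weylIsometry f).2]; simp [pencil]
  · rw [(weylIsometry f).1, inter_pencil]; simp [pencil]

/-- With d = deg f, the vector dℓ_q + e_q - f⁻¹(e₀) has degree 0, anticanonical degree 2d - 2 and
square -(2d - 2), the equality case of `anticanonical_le`. This is the classical type (d; d-1,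
1^(2d-2)). -/
lemma HasCenter.exists_finset {f : Weyl k} {q : BubbleSpace k} (h : HasCenter f q) :
    ∃ S : Finset (BubbleSpace k), q ∉ S ∧ (S.card : ℤ) = 2 * (f.1⁻¹ e₀).1 - 2 ∧
      f.1⁻¹ e₀ = (f.1⁻¹ e₀).1 • pencil q + e q - ∑ p ∈ S, e p := by
  classical
  have h1 : inter (f.1⁻¹ e₀) (pencil q) = 1 := by rw [← weyl_fst_apply f]; exact h
  have h2 : inter (f.1⁻¹ e₀) (f.1⁻¹ e₀) = 1 := by rw [(weylIsometry f).inv.1, inter_e₀_left]; rfl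
  have h3 : anticanonical (f.1⁻¹ e₀) = 3 := by rw [(weylIsometry f).inv.2, anticanonical_e₀]
  set v := f.1⁻¹ e₀
  have h4 : v.1 + v.2 q = 1 := by rw [← inter_pencil, h1]
  have h5 : v.2 q = 1 - v.1 := by linarith
  have h6 : inter (pencil q) (pencil q) = 0 := by rw [inter_pencil]; simp [pencil]
  set z := v.1 • pencil q + e q - v with hz
  have z0 : z.1 = 0 := by simp [hz, pencil]
  have z1 : anticanonical z = 2 * v.1 - 2 := by simp [hz, pencil, h3]; ring
  have z2 : inter z z = -(2 * v.1 - 2) := by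
    simp only [hz, inter_sub_left, inter_add_left, inter_smul_left, inter_sub_right,
      inter_add_right, inter_smul_right, h1, h2, inter_comm (pencil q) v, inter_e_left,
      inter_e_right]
    rw [h6]
    simp [h5, pencil]
    ring
  obtain ⟨S, hS, hc⟩ := exists_eq_sum_e z0 (by rw [z1, z2]; ring)
  refine ⟨S, fun hq => ?_, by rw [← hc, z1], by rw [← hS, hz]; abel⟩
  have z3 : z.2 q = 0 := by simp [hz, pencil, h5]; ring
  rw [hS, sum_e_snd, if_pos hq] at z3
  exact one_ne_zero z3

lemma fst_apply_eq {f : Weyl k} {q : BubbleSpace k} {S : Finset (BubbleSpace k)}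
    (h : f.1⁻¹ e₀ = (f.1⁻¹ e₀).1 • pencil q + e q - ∑ p ∈ S, e p)
    (v : PicardManin (BubbleSpace k)) :
    (f.1 v).1 = (f.1⁻¹ e₀).1 * inter v (pencil q) - v.2 q + ∑ p ∈ S, v.2 p := by
  have h1 : ∀ T : Finset (BubbleSpace k), inter v (∑ p ∈ T, e p) = -∑ p ∈ T, v.2 p := by
    classical
    intro T
    induction T using Finset.induction_on with
    | empty => simp [inter]
    | insert p T hp ih =>
      rw [Finset.sum_insert hp, Finset.sum_insert hp, inter_add_right, ih, inter_e_right]; ring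
  rw [weyl_fst_apply f, inter_comm, h, inter_sub_right, inter_add_right, inter_smul_right, h1,
    inter_e_right, ← h]
  ring

lemma HasCenter.mul_refl {f : Weyl k} {q : BubbleSpace k} (h : HasCenter f q)
    {β : PicardManin (BubbleSpace k)} (hβ : IsRoot β) (hq : inter β (pencil q) = 0) :
    HasCenter (f * ⟨hβ.refl, refl_mem_weyl hβ hq⟩) q := by
  change (f.1 (hβ.refl (pencil q))).1 = 1
  rw [hβ.refl_apply, inter_comm, hq, zero_smul, add_zero]
  exact h

/-- Moving the center to a point of higher multiplicity. -/
lemma HasCenter.exists_bruhatLE {f : Weyl k} {q q' : BubbleSpace k} (h : HasCenter f q)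
    {v : PicardManin (BubbleSpace k)} (hv : v.2 q' ≤ v.2 q) :
    ∃ g, HasCenter g q' ∧ BruhatLE (g.1 v) (f.1 v) := by
  classical
  by_cases hne : q = q'
  · exact ⟨f, hne ▸ h, .refl⟩
  obtain ⟨S, hqS, hS, hf⟩ := h.exists_finset
  have hγ := isRoot_sub hne
  refine ⟨f * ⟨hγ.refl, sym_le_weyl (isRoot_sub_refl_mem hne)⟩, ?_,
    (weylIsometry f).refl_bruhatLE hγ ?_ ?_⟩
  · change (f.1 (hγ.refl (pencil q'))).1 = 1
    have : hγ.refl (pencil q') = pencil q := by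
      rw [hγ.refl_apply, inter_comm, inter_pencil]
      simp [pencil, e_snd_of_ne (Ne.symm hne)]
    rw [this]; exact h
  -- With d = deg f, f(e_q) has degree d - 1 and f(e_q') has degree 1 or 0. In the first case S is
  -- nonempty, so d ≥ 2.
  · rw [fst_apply_eq hf, inter_pencil]
    have h1 : ∑ p ∈ S, (e q - e q').2 p = -if q' ∈ S then 1 else 0 := by
      simp [e, Finsupp.single_apply, hqS]
    rw [h1]
    simp only [Prod.fst_sub, Prod.snd_sub, Finsupp.sub_apply, e_fst, e_snd_self, e_snd_of_ne hne]
    split_ifs with hq'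
    · have : 0 < S.card := Finset.card_pos.2 ⟨_, hq'⟩
      omega
    · omega
  · rw [inter_sub_right, inter_e_right, inter_e_right]; linarith

/-- Two Jonquières elements with the same center are equal modulo `Sym`, or separated by a root
orthogonal to the pencil of lines through the center. -/
lemma HasCenter.eq_or_exists_root {f g : Weyl k} {q : BubbleSpace k} (hf : HasCenter f q)
    (hg : HasCenter g q) : f.1⁻¹ e₀ = g.1⁻¹ e₀ ∨ ∃ γ, IsRoot γ ∧ inter γ (pencil q) = 0 ∧
      (f.1 γ).1 = -1 ∧ (g.1 γ).1 = 1 := by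
  classical
  obtain ⟨S, hqS, hS, hf⟩ := hf.exists_finset
  obtain ⟨T, hqT, hT, hg⟩ := hg.exists_finset
  rw [or_iff_not_imp_left]
  intro hne
  -- The root is e₀ - e_q - e_p - e_r: the term of q is 1, and p, r contribute -2 over S and 0 over
  -- T.
  have key : ∀ {S T : Finset (BubbleSpace k)}, q ∉ S → q ∉ T → ∀ {p r}, p ∈ S → p ∉ T → r ∈ S →
      r ∉ T → p ≠ r → ∃ γ, IsRoot γ ∧ inter γ (pencil q) = 0 ∧
      -γ.2 q + ∑ p ∈ S, γ.2 p = -1 ∧ -γ.2 q + ∑ p ∈ T, γ.2 p = 1 := by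
    intro S T hqS hqT p r hpS hpT hrS hrT hpr
    have hqp : q ≠ p := by rintro rfl; exact hqS hpS
    have hqr : q ≠ r := by rintro rfl; exact hqS hrS
    refine ⟨_, isRoot_e₀_sub hqp hqr hpr, ?_, ?_, ?_⟩
    · rw [inter_pencil]; simp [e_snd_of_ne hqp, e_snd_of_ne hqr]
    · simp [e, Finsupp.single_apply, hpS, hrS, hqS, hqp.symm, hqr.symm]
    · simp [e, Finsupp.single_apply, hpT, hrT, hqT, hqp.symm, hqr.symm]
  -- Both cardinalities are even, so if they differ, they differ by at least 2.
  have hsub : ∀ {S T : Finset (BubbleSpace k)}, T.card < S.card → ((S.card : ℤ) - T.card) ≠ 1 →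
      ∃ p r, p ∈ S ∧ p ∉ T ∧ r ∈ S ∧ r ∉ T ∧ p ≠ r := by
    intro S T h h'
    have h1 := Finset.le_card_sdiff T S
    obtain ⟨p, hp, r, hr, hpr⟩ := Finset.one_lt_card.1 (by omega : 1 < (S \ T).card)
    rw [Finset.mem_sdiff] at hp hr
    exact ⟨p, r, hp.1, hp.2, hr.1, hr.2, hpr⟩
  suffices ∃ γ, IsRoot γ ∧ inter γ (pencil q) = 0 ∧
      -γ.2 q + ∑ p ∈ S, γ.2 p = -1 ∧ -γ.2 q + ∑ p ∈ T, γ.2 p = 1 by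
    obtain ⟨γ, h1, h2, h3, h4⟩ := this
    refine ⟨γ, h1, h2, ?_, ?_⟩
    · rw [fst_apply_eq hf, h2]; linarith
    · rw [fst_apply_eq hg, h2]; linarith
  rcases lt_trichotomy S.card T.card with h | h | h
  · obtain ⟨p, r, h1, h2, h3, h4, h5⟩ := hsub h (by omega)
    obtain ⟨γ, g1, g2, g3, g4⟩ := key hqT hqS h1 h2 h3 h4 h5
    refine ⟨-γ, g1.neg, by rw [inter_neg_left, g2, neg_zero], ?_, ?_⟩
    · simp only [Prod.snd_neg, Finsupp.neg_apply, Finset.sum_neg_distrib]; linarith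
    · simp only [Prod.snd_neg, Finsupp.neg_apply, Finset.sum_neg_distrib]; linarith
  -- For equal cardinalities, e_r - e_p with p in S \ T and r in T \ S separates f and g.
  · have hST : S ≠ T := by
      rintro rfl
      apply hne
      rw [hf, hg, show (f.1⁻¹ e₀).1 = (g.1⁻¹ e₀).1 by omega]
    obtain ⟨p, hpS, hpT⟩ := Finset.not_subset.1
      fun hs => hST (Finset.eq_of_subset_of_card_le hs h.ge)
    obtain ⟨r, hrT, hrS⟩ := Finset.not_subset.1
      fun hs => hST (Finset.eq_of_subset_of_card_le hs h.le).symm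
    have hrp : r ≠ p := by rintro rfl; exact hpT hrT
    have hqp : q ≠ p := by rintro rfl; exact hqS hpS
    have hqr : q ≠ r := by rintro rfl; exact hqT hrT
    refine ⟨_, isRoot_sub hrp, ?_, ?_, ?_⟩
    · rw [inter_pencil]; simp [e_snd_of_ne hqp, e_snd_of_ne hqr]
    · simp [e, Finsupp.single_apply, hpS, hrS, hqp.symm, hqr.symm]
    · simp [e, Finsupp.single_apply, hpT, hrT, hqp.symm, hqr.symm]
  · obtain ⟨p, r, h1, h2, h3, h4, h5⟩ := hsub h (by omega)
    exact key hqS hqT h1 h2 h3 h4 h5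

/-- The degree is deg f + deg g - 1 - |S ∩ T|, and |S ∩ T| is at most the mean deg f + deg g - 2 of
|S| and |T|. It serves as a measure of the distance from f to g. -/
lemma HasCenter.fst_nonneg {f g : Weyl k} {q : BubbleSpace k} (hf : HasCenter f q)
    (hg : HasCenter g q) : 0 ≤ (g.1 (f.1⁻¹ e₀)).1 := by
  classical
  obtain ⟨S, hqS, hS, hf⟩ := hf.exists_finset
  obtain ⟨T, hqT, hT, hg'⟩ := hg.exists_finset
  have h1 : ∀ p ∈ S, (g.1 (e p)).1 = if p ∈ T then 1 else 0 := by
    intro p hp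
    have hqp : q ≠ p := by rintro rfl; exact hqS hp
    rw [fst_apply_eq hg', inter_pencil]
    simp [e, Finsupp.single_apply, hqp.symm]
  have h2 : (g.1 (e q)).1 = (g.1⁻¹ e₀).1 - 1 := by
    rw [fst_apply_eq hg', inter_pencil]
    simp [e, Finsupp.single_apply, hqT]
  have h3 : (g.1 (pencil q)).1 = 1 := hg
  rw [hf, map_sub, map_add, map_smul, map_sum, Prod.fst_sub, Prod.fst_add, Prod.smul_fst,
    Prod.fst_sum, Finset.sum_congr rfl h1, h2, h3]
  have h4 : (∑ p ∈ S, if p ∈ T then (1 : ℤ) else 0) = (S ∩ T).card := by simp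
  have h5 := Finset.card_le_card (Finset.inter_subset_left (s₁ := S) (s₂ := T))
  have h6 := Finset.card_le_card (Finset.inter_subset_right (s₁ := S) (s₂ := T))
  rw [h4, smul_eq_mul]
  omega

lemma eqModSym_of_inv_eq {f g : Weyl k} (h : f.1⁻¹ e₀ = g.1⁻¹ e₀)
    (v : PicardManin (BubbleSpace k)) : EqModSym (f.1 v) (g.1 v) := by
  refine ⟨g.1 * f.1⁻¹, ((weylIsometry g).mul (weylIsometry f).inv).mem_sym ?_, ?_⟩
  · rw [LinearEquiv.mul_apply, h]
    exact g.1.apply_symm_apply _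
  · rw [LinearEquiv.mul_apply]
    exact congrArg g.1 (f.1.symm_apply_apply v).symm

/-- Take a root γ separating f and g. Comparing f with f s_γ, minimality gives v·γ ≤ 0, hence g
s_γ(v) ≤ g(v). As f⁻¹(e₀)·γ = -1 and deg g(γ) = 1, passing from g to g s_γ lowers deg g f⁻¹(e₀) by
1. -/
lemma HasCenter.bruhatLE_of_minimal {f g : Weyl k} {q : BubbleSpace k}
    {v : PicardManin (BubbleSpace k)} (hf : HasCenter f q) (hg : HasCenter g q)
    (hmin : ∀ f', HasCenter f' q → (f.1 v).1 ≤ (f'.1 v).1) : BruhatLE (f.1 v) (g.1 v) := by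
  induction hn : (g.1 (f.1⁻¹ e₀)).1.toNat using Nat.strong_induction_on generalizing g with
  | _ n ih =>
    rcases hf.eq_or_exists_root hg with h | ⟨γ, hγ, hq, hfγ, hgγ⟩
    · exact (eqModSym_of_inv_eq h v).bruhatLE
    have hf' := hf.mul_refl hγ hq
    have hg' := hg.mul_refl hγ hq
    have h1 : inter v γ ≤ 0 := by
      have h2 := hmin _ hf'
      change _ ≤ (f.1 (hγ.refl v)).1 at h2
      rw [hγ.refl_apply, map_add, map_smul, Prod.fst_add, Prod.smul_fst, hfγ, smul_eq_mul] at h2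
      linarith
    refine .trans (ih _ ?_ hg' rfl) ((weylIsometry g).refl_bruhatLE hγ (by omega) h1)
    have h3 := hf.fst_nonneg hg'
    have h4 : (g.1 (hγ.refl (f.1⁻¹ e₀))).1 = (g.1 (f.1⁻¹ e₀)).1 - 1 := by
      rw [hγ.refl_apply, ← weyl_fst_apply f, map_add, map_smul, Prod.fst_add, Prod.smul_fst,
        hfγ, hgγ]
      simp [sub_eq_add_neg]
    change 0 ≤ (g.1 (hγ.refl (f.1⁻¹ e₀))).1 at h3
    change (g.1 (hγ.refl (f.1⁻¹ e₀))).1.toNat < n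
    omega

/-! ### Predecessors and the order -/

/-- A predecessor is the smallest of the images under the Jonquières elements. -/
lemma IsPredecessor.bruhatLE {v a : PicardManin (BubbleSpace k)} (h : IsPredecessor v a)
    {ψ : Weyl k} (hψ : IsJonquieres ψ) : BruhatLE a (ψ.1 v) := by
  obtain ⟨⟨φ, hφ, rfl⟩, hmin⟩ := h
  simp only [deg_eq, isJonquieres_iff] at hmin hφ hψ
  obtain ⟨q, hφ⟩ := hφ
  obtain ⟨q', hψ⟩ := hψ
  -- Multiplicities are the negatives of the coefficients, so in the first case q has the larger
  -- multiplicity.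
  rcases le_total (v.2 q) (v.2 q') with hv | hv
  · obtain ⟨g, hg, hle⟩ := hψ.exists_bruhatLE hv
    exact (hφ.bruhatLE_of_minimal hg fun f' hf' => hmin f' ⟨q, hf'⟩).trans hle
  · obtain ⟨g, hg, hle⟩ := hφ.exists_bruhatLE hv
    -- Here g(v) ≤ φ(v) while φ(v) has minimal degree, so the two are equal modulo Sym and g is
    -- minimal for the center q'.
    obtain ⟨h1, -, h2⟩ := hle.le
    have h3 := h1.antisymm (hmin g ⟨q', hg⟩)
    refine (h2 h3).symm.bruhatLE.trans (hg.bruhatLE_of_minimal hψ fun f' hf' => ?_)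
    exact h3.le.trans (hmin f' ⟨q', hf'⟩)

/-- The lower bounds of the images under the Jonquières elements are preserved when one goes up in
the order. -/
lemma bruhatLE_apply_of_step {a u w : PicardManin (BubbleSpace k)} (h : BruhatStep u w)
    (ha : ∀ ψ : Weyl k, IsJonquieres ψ → BruhatLE a (ψ.1 u)) {ψ : Weyl k} (hψ : IsJonquieres ψ) :
    BruhatLE a (ψ.1 w) := by
  obtain ⟨q, hq⟩ := (isJonquieres_iff ψ).1 hψ
  rcases h with ⟨f, hf, rfl⟩ | ⟨β, h, hd, hu, rfl⟩
  · refine ha (ψ * ⟨f, sym_le_weyl hf⟩) ((isJonquieres_iff _).2 ?_)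
    obtain ⟨h0, t, ht⟩ := hf
    refine ⟨t.symm q, ?_⟩
    change (ψ.1 (f (pencil (t.symm q)))).1 = 1
    rw [pencil, map_sub, h0, ht, Equiv.apply_symm_apply]
    exact hq
  · rcases le_or_gt 0 (ψ.1 β).1 with h1 | h1
    · exact (ha ψ hψ).trans ((weylIsometry ψ).bruhatLE_refl h h1 hu)
    -- As -ψ(β) is a root of positive degree, ψ(β)·ψ(ℓ_q) ≤ 0, whereas β·ℓ_q ≥ 0. So s_β fixes ℓ_q
    -- and lies in W.
    · have h2 : inter β (pencil q) = 0 := by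
        refine le_antisymm ?_ (h.inter_pencil_nonneg hd q)
        obtain ⟨q', hq'⟩ := hq.exists_eq_pencil
        rw [← (weylIsometry ψ).1, hq']
        have h3 := ((weylIsometry ψ).isRoot h).neg.inter_pencil_nonneg (by simpa using h1) q'
        rw [inter_neg_left] at h3
        linarith
      exact ha _ ((isJonquieres_iff _).2 ⟨q, hq.mul_refl h h2⟩)

/-- The induction along the chain must keep ψ arbitrary, since a step may replace ψ by ψ s_β. -/
lemma IsPredecessor.bruhatLE_of_bruhatLE {u w a : PicardManin (BubbleSpace k)}
    (h : IsPredecessor u a) (hw : BruhatLE u w) {ψ : Weyl k} (hψ : IsJonquieres ψ) :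
    BruhatLE a (ψ.1 w) := by
  induction hw generalizing ψ with
  | refl => exact h.bruhatLE hψ
  | tail _ hs ih => exact bruhatLE_apply_of_step hs (fun _ h => ih h) hψ

lemma IsNthPredecessor.bruhatLE {n : ℕ} {u a : PicardManin (BubbleSpace k)}
    (h : IsNthPredecessor n u a) {ψ : ℕ → Weyl k}
    (hψ : ∀ i, 1 ≤ i → i ≤ n → IsJonquieres (ψ i)) : BruhatLE a ((compUpTo ψ n).1 u) := by
  induction n generalizing a with
  | zero =>
    obtain rfl : a = u := h
    exact .refl
  | succ n ih =>
    obtain ⟨c, hc, ha⟩ := h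
    exact ha.bruhatLE_of_bruhatLE (ih hc fun i h1 h2 => hψ i h1 (by omega))
      (hψ _ (by omega) le_rfl)

end Weyl

end Cremona

theorem proposition3 (k : Type*) [Field k] [IsAlgClosed k] (n : ℕ) (hn : 1 ≤ n)
    (a₀ aₙ : Cremona.PicardManin (Cremona.BubbleSpace k))
    (ha₀ : a₀ ∈ Cremona.orbitE₀ k)
    (haₙ : Cremona.IsNthPredecessor n a₀ aₙ)
    (ψ : ℕ → Cremona.Weyl k)
    (hψ : ∀ i, 1 ≤ i → i ≤ n → Cremona.IsJonquieres (ψ i))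
    (bₙ : Cremona.PicardManin (Cremona.BubbleSpace k))
    (hbₙ : bₙ = (Cremona.compUpTo ψ n).1 a₀) :
    Cremona.deg aₙ ≤ Cremona.deg bₙ ∧
    Cremona.comult aₙ ≤ Cremona.comult bₙ ∧
    (Cremona.deg aₙ = Cremona.deg bₙ → Cremona.EqModSym aₙ bₙ) := by
  subst hbₙ
  simp only [Cremona.deg_eq]
  exact (haₙ.bruhatLE hψ).le
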